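/- Let $P$ be a parallelogram in the plane with long side of length $\ell$ and short side of length $s$, $\ell\ge s>0$, positioned so that the long side is vertical and the short side is parallel to $(\sin\theta_0,\cos\theta_0)$, where $0<\theta_0\le \pi/2$ is the non-obtuse angle of $P$. Put $A=\ell/s$. Let $\mathcal P$ be a finite set of points in the plane in general position: no four points of $\mathcal P$ lie on the boundary of a common scaled translate of $P$ (positive scaling factor), and no two points of $\mathcal P$ lie on a line parallel to a side of $P$. The parallelogram Delaunay graph $T$ has vertex set $\mathcal P$, and two distinct vertices are adjacent if and only if some scaled translate of $P$ has both of them on its boundary and no point of $\mathcal P$ in its interior. Let $d_2^T(a,b)$ be the length of a shortest path in $T$ from $a$ to $b$ (edges weighted by Euclidean length; $\infty$ if there is no path). Let $a,b\in\mathcal P$ with $x_a<x_b$ and let $S=\frac{y_b-y_a}{x_b-x_a}$. Define a basis $\{\hat x,\hat y\}$ and an angle $\theta$ (the interior angle between $\hat x$ and $\hat y$) as follows. - Scenario 1, $S\in\left(-\infty,\frac{\cos\theta_0-A}{\sin\theta_0}\right]$: $\hat x=(0,-1)$, $\hat y=(\sin\theta_0,\cos\theta_0)$, $\theta=\pi-\theta_0$.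 - Scenario 2, $S\in\left(\frac{\cos\theta_0-A}{\sin\theta_0},\frac{\cos\theta_0}{\sin\theta_0}\right]$: $\hat x=(\sin\theta_0,\cos\theta_0)$, $\hat y=(0,-1)$, $\theta=\pi-\theta_0$. - Scenario 3, $S\in\left(\frac{\cos\theta_0}{\sin\theta_0},\frac{\cos\theta_0+A}{\sin\theta_0}\right]$: $\hat x=(\sin\theta_0,\cos\theta_0)$, $\hat y=(0,1)$, $\theta=\theta_0$. - Scenario 4, $S\in\left(\frac{\cos\theta_0+A}{\sin\theta_0},\infty\right)$: $\hat x=(0,1)$, $\hat y=(\sin\theta_0,\cos\theta_0)$, $\theta=\theta_0$. Write $b-a=\hat x_b\,\hat x+\hat y_b\,\hat y$. Then in Scenarios 2 and 3 $$d_2^T(a,b)\le\left(A+\sqrt{1+A^2+2A|\cos\theta|}\right)\hat x_b+\hat y_b,$$ and in Scenarios 1 and 4 $$d_2^T(a,b)\le\left(1+\sqrt{1+\frac1{A^2}+\frac{2|\cos\theta|}{A}}\right)\hat x_b+A\,\hat y_b.$$ -/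

import Mathlib

open scoped ENNReal

namespace ParallelogramDelaunay

noncomputable section

/-- The Euclidean plane. -/
abbrev Plane : Type := EuclideanSpace ℝ (Fin 2)

/-- Unit vector along the (vertical) long side. -/
def longDir : Plane := !₂[0, 1]

/-- Unit vector along the short side: it makes the angle `θ₀` with the vertical direction, so its
slope `cos θ₀ / sin θ₀` is non-negative for `0 < θ₀ ≤ π / 2`. -/
def shortDir (θ₀ : ℝ) : Plane := !₂[Real.sin θ₀, Real.cos θ₀]

/-- The (closed, filled) parallelogram with a vertical long side of length `l`, a short side of
length `s`, and angle `θ₀` between them; one corner is at the origin. -/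
def parallelogram (l s θ₀ : ℝ) : Set Plane :=
  parallelepiped ![l • longDir, s • shortDir θ₀]

/-- The translate by `c` of the scaling of `P` by the factor `t`. -/
def scaledTranslate (P : Set Plane) (c : Plane) (t : ℝ) : Set Plane :=
  (fun z : Plane => c + t • z) '' P

/-- The Delaunay graph of the point set `V` with respect to the shape `P`: two distinct vertices
are adjacent iff some scaled translate of `P` has both on its boundary and no vertex in its
interior. -/
def delaunayGraph (P : Set Plane) (V : Finset Plane) : SimpleGraph V where
  Adj u v := u ≠ v ∧ ∃ (c : Plane) (t : ℝ), 0 < t ∧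
    (u : Plane) ∈ frontier (scaledTranslate P c t) ∧
    (v : Plane) ∈ frontier (scaledTranslate P c t) ∧
    ∀ p ∈ V, p ∉ interior (scaledTranslate P c t)
  symm := ⟨fun _ _ ⟨h, c, t, ht, hu, hv, hV⟩ => ⟨h.symm, c, t, ht, hv, hu, hV⟩⟩
  loopless := ⟨fun _ h => h.1 rfl⟩

/-- General position with respect to the parallelogram: no four vertices lie on the boundary of
a common scaled translate, and no two vertices lie on a line parallel to one of the sides. -/
structure GeneralPosition (l s θ₀ : ℝ) (V : Finset Plane) : Prop where
  no_four : ∀ (c : Plane) (t : ℝ), 0 < t → ∀ Q ⊆ V, Q.card = 4 →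
    ¬ ((Q : Set Plane) ⊆ frontier (scaledTranslate (parallelogram l s θ₀) c t))
  no_two_long : ∀ p ∈ V, ∀ q ∈ V, p ≠ q → ∀ r : ℝ, q - p ≠ r • longDir
  no_two_short : ∀ p ∈ V, ∀ q ∈ V, p ≠ q → ∀ r : ℝ, q - p ≠ r • shortDir θ₀

/-- The Euclidean length of a walk: the sum of the Euclidean lengths of its edges. -/
def walkLength {V : Finset Plane} {G : SimpleGraph V} {u v : V} (w : G.Walk u v) : ℝ≥0∞ :=
  (w.darts.map fun d => edist (d.fst : Plane) (d.snd : Plane)).sum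

/-- The length of a shortest path from `u` to `v` in `G`; it is `∞` if there is no path. -/
def graphDist {V : Finset Plane} (G : SimpleGraph V) (u v : V) : ℝ≥0∞ :=
  ⨅ w : G.Walk u v, walkLength w

/-- Taking the infimum over all walks or over all paths makes no difference. -/
theorem graphDist_eq_iInf_path {V : Finset Plane} (G : SimpleGraph V) (u v : V) :
    graphDist G u v = ⨅ p : G.Path u v, walkLength (p : G.Walk u v) := by
  classical
  refine le_antisymm (le_iInf fun p => iInf_le _ _) (le_iInf fun w => ?_)
  refine (iInf_le _ w.toPath).trans ?_
  exact ((SimpleGraph.Walk.darts_bypass_sublist_darts w).map _).sum_le_sum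
    fun _ _ => by simp

/-- The four scenarios for the slope of the segment from `a` to `b`. -/
inductive Scenario : Type
  | one
  | two
  | three
  | four

namespace Scenario

/-- The range of slopes of each scenario (`A` is the aspect ratio). -/
def slopes (A θ₀ : ℝ) : Scenario → Set ℝ
  | one => Set.Iic ((Real.cos θ₀ - A) / Real.sin θ₀)
  | two => Set.Ioc ((Real.cos θ₀ - A) / Real.sin θ₀) (Real.cos θ₀ / Real.sin θ₀)
  | three => Set.Ioc (Real.cos θ₀ / Real.sin θ₀) ((Real.cos θ₀ + A) / Real.sin θ₀)
  | four => Set.Ioi ((Real.cos θ₀ + A) / Real.sin θ₀)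

/-- The first basis vector of each scenario. -/
def xHat (θ₀ : ℝ) : Scenario → Plane
  | one => !₂[0, -1]
  | two => !₂[Real.sin θ₀, Real.cos θ₀]
  | three => !₂[Real.sin θ₀, Real.cos θ₀]
  | four => !₂[0, 1]

/-- The second basis vector of each scenario. -/
def yHat (θ₀ : ℝ) : Scenario → Plane
  | one => !₂[Real.sin θ₀, Real.cos θ₀]
  | two => !₂[0, -1]
  | three => !₂[0, 1]
  | four => !₂[Real.sin θ₀, Real.cos θ₀]

/-- The interior angle between the two basis vectors of each scenario. -/
def theta (θ₀ : ℝ) : Scenario → ℝ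
  | one => Real.pi - θ₀
  | two => Real.pi - θ₀
  | three => θ₀
  | four => θ₀

/-- Signed area spanned by two vectors. -/
def area (u v : Plane) : ℝ := u 0 * v 1 - u 1 * v 0

/-- The first coordinate of `u` in the basis of the scenario (by Cramer's rule). -/
def xCoord (σ : Scenario) (θ₀ : ℝ) (u : Plane) : ℝ :=
  area u (σ.yHat θ₀) / area (σ.xHat θ₀) (σ.yHat θ₀)

/-- The second coordinate of `u` in the basis of the scenario (by Cramer's rule). -/
def yCoord (σ : Scenario) (θ₀ : ℝ) (u : Plane) : ℝ :=
  area (σ.xHat θ₀) u / area (σ.xHat θ₀) (σ.yHat θ₀)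

/-- The coordinates are the ones in the basis. -/
theorem eq_coord_smul_add (σ : Scenario) {θ₀ : ℝ} (h : Real.sin θ₀ ≠ 0) (u : Plane) :
    u = σ.xCoord θ₀ u • σ.xHat θ₀ + σ.yCoord θ₀ u • σ.yHat θ₀ := by
  ext i
  cases σ <;> fin_cases i <;> simp [xCoord, yCoord, area, xHat, yHat] <;> field_simp <;> ring

end Scenario

end

end ParallelogramDelaunay

/-! In the coordinates `shortCoord` and `longCoord`, scaled translates of the parallelogram are
axis-parallel squares. A Euclidean length is at most `l` times the octagonal norm with `K =
diagonalRatio`, the ratio of the longer diagonal to `l`, and `1 ≤ K ≤ 2`. All four scenarios then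
follow from one claim (`good`): two points with coordinate differences `dx`, `dy` are joined by a
walk of length at most `(1 + K) * max dx dy + min dx dy`.

The claim is proved by induction on `max dx dy`; by symmetry `b` is above and to the right of `a`
and `dy ≤ dx` (a gentle pair). A further point in the rectangle spanned by `a` and `b` splits the
problem (`good_of_rect`, `good_of_steep_point`). If there is none, a sequence of empty squares moves
from `a` to the right. Each has a point `h` above the rectangle and a point `l` below it, and a
potential bounds the sum of the lengths of the walks to both (`Ladder`). When the right side of the
square meets `c`, the two walks continued to `c` have total length at most `4 * (X c - X a)`, so one
of them has length at most `2 * (X c - X a)`. This suffices if `c = b`. If instead the edge from the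
opposite end to `c` is gentle, its octagonal length is small enough to let
`within_of_emptySquare_left` finish. Otherwise `c` replaces an end of the ladder, which progresses
to the right and so terminates. -/

namespace ParallelogramDelaunay

/-! ### The octagonal norm. -/

/-- The octagonal norm with value `1` on the unit vectors and `K` on `(±1, ±1)`. -/
def octNorm (K p q : ℝ) : ℝ := max |p| |q| + (K - 1) * min |p| |q|

theorem octNorm_le_add {K : ℝ} (hK : K ≤ 2) (p q : ℝ) : octNorm K p q ≤ |p| + |q| := by
  have h := max_add_min |p| |q|
  have h0 : 0 ≤ min |p| |q| := le_min (abs_nonneg _) (abs_nonneg _)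
  unfold octNorm
  nlinarith

theorem octNorm_nonneg {K : ℝ} (hK : 1 ≤ K) (p q : ℝ) : 0 ≤ octNorm K p q := by
  have : 0 ≤ K - 1 := sub_nonneg.2 hK
  unfold octNorm
  positivity

theorem octNorm_of_le {K p q : ℝ} (h : |q| ≤ |p|) : octNorm K p q = |p| + (K - 1) * |q| := by
  rw [octNorm, max_eq_left h, min_eq_right h]

theorem octNorm_comm (K p q : ℝ) : octNorm K p q = octNorm K q p := by
  rw [octNorm, octNorm, max_comm, min_comm]

theorem octNorm_neg_left (K p q : ℝ) : octNorm K (-p) q = octNorm K p q := by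
  simp [octNorm]

theorem octNorm_neg_right (K p q : ℝ) : octNorm K p (-q) = octNorm K p q := by
  simp [octNorm]

/-! ### Empty squares and walks between points that share one. -/

section

variable {ι : Type*}

/-- No point has its coordinates in the open square with lower left corner `(p, q)` and
side `w`. -/
def EmptySquare (X Y : ι → ℝ) (p q w : ℝ) : Prop :=
  ∀ z, p < X z → X z < p + w → q < Y z → Y z < q + w → False

/-- Two distinct points lie in a common closed square whose interior is empty. -/
def SquareAdj (X Y : ι → ℝ) (u v : ι) : Prop :=
  u ≠ v ∧ ∃ p q w : ℝ, 0 < w ∧ (p ≤ X u ∧ X u ≤ p + w ∧ q ≤ Y u ∧ Y u ≤ q + w) ∧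
    (p ≤ X v ∧ X v ≤ p + w ∧ q ≤ Y v ∧ Y v ≤ q + w) ∧ EmptySquare X Y p q w

/-- `Within X Y K u v r`: some walk of square adjacencies from `u` to `v` has length at most `r`
in the octagonal norm. -/
inductive Within (X Y : ι → ℝ) (K : ℝ) : ι → ι → ℝ → Prop
  | refl (u : ι) (r : ℝ) (hr : 0 ≤ r) : Within X Y K u u r
  | cons (u v w : ι) (r s : ℝ) (huv : SquareAdj X Y u v) (hvw : Within X Y K v w r)
      (hrs : octNorm K (X u - X v) (Y u - Y v) + r ≤ s) : Within X Y K u w s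

variable {X Y : ι → ℝ} {K : ℝ} {a b c h l u v w : ι} {r r' : ℝ}

theorem EmptySquare.neg_right {p q t : ℝ} (H : EmptySquare X Y p q t) :
    EmptySquare X (fun i => -Y i) p (-(q + t)) t :=
  fun z h1 h2 h3 h4 => H z h1 h2 (by linarith) (by linarith)

theorem EmptySquare.mono {p q t p' q' t' : ℝ} (H : EmptySquare X Y p q t) (hp : p ≤ p')
    (hq : q ≤ q') (hpt : p' + t' ≤ p + t) (hqt : q' + t' ≤ q + t) : EmptySquare X Y p' q' t' :=
  fun z h1 h2 h3 h4 => H z (by linarith) (by linarith) (by linarith) (by linarith)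

theorem SquareAdj.symm (H : SquareAdj X Y u v) : SquareAdj X Y v u := by
  obtain ⟨h, p, q, t, ht, hu, hv, he⟩ := H
  exact ⟨h.symm, p, q, t, ht, hv, hu, he⟩

theorem SquareAdj.swap (H : SquareAdj X Y u v) : SquareAdj Y X u v := by
  obtain ⟨h, p, q, t, ht, hu, hv, he⟩ := H
  exact ⟨h, q, p, t, ht, by tauto, by tauto, fun z h1 h2 h3 h4 => he z h3 h4 h1 h2⟩

theorem SquareAdj.neg_right (H : SquareAdj X Y u v) : SquareAdj X (fun i => -Y i) u v := by
  obtain ⟨h, p, q, t, ht, ⟨_, _, _, _⟩, ⟨_, _, _, _⟩, he⟩ := H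
  refine ⟨h, p, -(q + t), t, ht, ⟨?_, ?_, ?_, ?_⟩, ⟨?_, ?_, ?_, ?_⟩, he.neg_right⟩ <;> linarith

theorem Within.mono (H : Within X Y K u v r) (hr : r ≤ r') : Within X Y K u v r' := by
  cases H with
  | refl _ _ h0 => exact .refl _ _ (h0.trans hr)
  | cons _ x _ s _ h1 h2 h3 => exact .cons _ x _ s _ h1 h2 (h3.trans hr)

theorem Within.nonneg (hK : 1 ≤ K) (H : Within X Y K u v r) : 0 ≤ r := by
  induction H with
  | refl _ _ h0 => exact h0
  | cons _ _ _ _ _ _ _ h3 ih => exact (add_nonneg (octNorm_nonneg hK _ _) ih).trans h3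

theorem Within.trans (H : Within X Y K u v r) (H' : Within X Y K v w r') :
    Within X Y K u w (r + r') := by
  induction H with
  | refl _ _ h0 => exact H'.mono (by linarith)
  | cons _ x _ s _ h1 _ h3 ih => exact .cons _ x _ _ _ h1 (ih H') (by linarith)

theorem SquareAdj.within (H : SquareAdj X Y u v) :
    Within X Y K u v (octNorm K (X u - X v) (Y u - Y v)) :=
  .cons _ v _ 0 _ H (.refl _ _ le_rfl) (by simp)

theorem SquareAdj.within_add (hK : K ≤ 2) (H : SquareAdj X Y u v) :
    Within X Y K u v (|X u - X v| + |Y u - Y v|) :=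
  H.within.mono (octNorm_le_add hK _ _)

theorem Within.symm (H : Within X Y K u v r) : Within X Y K v u r := by
  induction H with
  | refl _ _ h0 => exact .refl _ _ h0
  | cons y x _ s _ h1 _ h3 ih =>
    refine (ih.trans h1.symm.within).mono ?_
    rw [← neg_sub (X y), ← neg_sub (Y y), octNorm_neg_left, octNorm_neg_right]
    linarith

theorem Within.swap (H : Within X Y K u v r) : Within Y X K u v r := by
  induction H with
  | refl _ _ h0 => exact .refl _ _ h0
  | cons _ x _ s _ h1 _ h3 ih =>
    exact .cons _ x _ s _ h1.swap ih (by rwa [octNorm_comm])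

theorem Within.neg_right (H : Within X Y K u v r) : Within X (fun i => -Y i) K u v r := by
  induction H with
  | refl _ _ h0 => exact .refl _ _ h0
  | cons y x _ s _ h1 _ h3 ih =>
    refine .cons _ x _ s _ h1.neg_right ih ?_
    rwa [show -Y y - -Y x = -(Y y - Y x) by ring, octNorm_neg_right]

theorem Within.of_neg_right (H : Within X (fun i => -Y i) K u v r) : Within X Y K u v r := by
  simpa using H.neg_right

/-- Growing a square from a fixed lower left corner until it reaches a point. -/
theorem exists_first_in_quadrant [Finite ι] (X Y : ι → ℝ) {p q : ℝ} (hp : p < X b)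
    (hq : q < Y b) :
    ∃ c, p < X c ∧ q < Y c ∧ max (X c - p) (Y c - q) ≤ max (X b - p) (Y b - q) ∧
      EmptySquare X Y p q (max (X c - p) (Y c - q)) := by
  obtain ⟨c, ⟨h1, h2⟩, hc⟩ := Set.exists_min_image {z | p < X z ∧ q < Y z}
    (fun z => max (X z - p) (Y z - q)) (Set.toFinite _) ⟨b, hp, hq⟩
  refine ⟨c, h1, h2, hc b ⟨hp, hq⟩, fun z h3 h4 h5 h6 => ?_⟩
  have h7 := hc z ⟨h3, h5⟩
  have : max (X z - p) (Y z - q) < max (X c - p) (Y c - q) :=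
    max_lt (by linarith) (by linarith)
  linarith

/-- Sliding a square to the right until it reaches a point. -/
theorem exists_first_in_strip [Finite ι] (X Y : ι → ℝ) {e q t : ℝ} (he : e ≤ X b)
    (h1 : q < Y b) (h2 : Y b < q + t) (hE : EmptySquare X Y (e - t) q t) :
    ∃ c, e ≤ X c ∧ X c ≤ X b ∧ q < Y c ∧ Y c < q + t ∧
      ∀ e', e ≤ e' → e' ≤ X c → EmptySquare X Y (e' - t) q t := by
  obtain ⟨c, ⟨h3, h4, h5⟩, hc⟩ := Set.exists_min_image {z | e ≤ X z ∧ q < Y z ∧ Y z < q + t}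
    X (Set.toFinite _) ⟨b, he, h1, h2⟩
  refine ⟨c, h3, hc b ⟨he, h1, h2⟩, h4, h5, fun e' h6 h7 z h8 h9 h10 h11 => ?_⟩
  rcases lt_or_ge (X z) e with h12 | h12
  · exact hE z (by linarith) (by linarith) h10 h11
  · linarith [hc z ⟨h12, h10, h11⟩]

theorem wellFounded_gt_comp {α : Type*} [Finite α] (f : α → ℝ) :
    WellFounded fun x y => f y < f x :=
  haveI : IsTrans α fun x y => f y < f x := ⟨fun _ _ _ h1 h2 => h2.trans h1⟩
  haveI : Std.Irrefl fun x y : α => f y < f x := ⟨fun _ => lt_irrefl _⟩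
  Finite.wellFounded_of_trans_of_irrefl _

/-- From a point above and to the left of `b` with an empty square on its left, one reaches `b`
by descending until the direction to `b` is gentle. -/
theorem within_of_emptySquare_left [Finite ι] (hX : Function.Injective X)
    (hY : Function.Injective Y) (hK1 : 1 ≤ K) (hK2 : K ≤ 2)
    (IH : ∀ u, X a < X u → X u ≤ X b → |Y u - Y b| ≤ X b - X u →
      Within X Y K u b ((1 + K) * (X b - X u) + |Y u - Y b|)) (h : ι) :
    X a < X h → X h < X b → Y b < Y h → ∀ e, X h ≤ e → e ≤ X b → e - (Y h - Y b) ≤ X h →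
      EmptySquare X Y (e - (Y h - Y b)) (Y b) (Y h - Y b) →
      Within X Y K h b ((1 + K) * (X b - X h) + (Y h - Y b)) := by
  induction h using (wellFounded_gt_comp X).induction with
  | _ h ih =>
  intro h1 h2 h3 e h4 h5 h6 hE
  rcases le_or_gt (Y h - Y b) (X b - X h) with hg | hg
  · have := IH h h1 h2.le (by rwa [abs_of_pos (by linarith)])
    rwa [abs_of_pos (by linarith)] at this
  -- the strip is taken closed below, so that `b` itself counts
  obtain ⟨c, ⟨h7, h8, h9⟩, hc⟩ := Set.exists_min_image {z | e ≤ X z ∧ Y b ≤ Y z ∧ Y z < Y h}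
    X (Set.toFinite _) ⟨b, h5, le_rfl, h3⟩
  have hcb : X c ≤ X b := hc b ⟨h5, le_rfl, h3⟩
  have hE' : EmptySquare X Y (X c - (Y h - Y b)) (Y b) (Y h - Y b) := by
    intro z h10 h11 h12 h13
    rcases lt_or_ge (X z) e with h14 | h14
    · exact hE z (by linarith) (by linarith) h12 h13
    · linarith [hc z ⟨h14, h12.le, by linarith⟩]
  have hne : h ≠ c := by rintro rfl; exact lt_irrefl _ h9
  have hXc : X h < X c := lt_of_le_of_ne (by linarith) fun h => hne (hX h)
  -- The square slid right to `c` still contains `h`: the direction to `b` is steep, so `X c ≤ X b <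
  -- X h + (Y h - Y b)`.
  have hadj : SquareAdj X Y h c :=
    ⟨hne, _, _, _, by linarith, ⟨by linarith, by linarith, by linarith, by linarith⟩,
      ⟨by linarith, by linarith, by linarith, by linarith⟩, hE'⟩
  have hw := hadj.within_add hK2
  rw [abs_of_neg (by linarith), abs_of_pos (by linarith)] at hw
  rcases eq_or_ne c b with rfl | hcb'
  · refine hw.mono ?_
    nlinarith
  have h10 : X c < X b := lt_of_le_of_ne hcb fun h => hcb' (hX h)
  have h11 : Y b < Y c := lt_of_le_of_ne h8 fun h => hcb' (hY h.symm)
  refine (hw.trans (ih c hXc (by linarith) h10 h11 (X c) le_rfl hcb (by linarith)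
    (hE'.mono (by linarith) le_rfl (by linarith) (by linarith)))).mono ?_
  nlinarith

end
-- Gentle pairs with an empty rectangle: the ladder.
section
variable {ι : Type*} {X Y : ι → ℝ} {K : ℝ} {a b c h l : ι}

/-- The pair `(h, l)` straddles the rectangle spanned by `a` and `b`, its direction is steep, an
empty square with right side at `e` spans the strip between `h` and `l`, and the known walks from
`a` to `h` and `l`, of lengths `dh` and `dl`, are short. -/
structure Ladder (X Y : ι → ℝ) (K : ℝ) (a b h l : ι) (e dh dl : ℝ) : Prop where
  ha : Y a ≤ Y h
  hb : Y b ≤ Y h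
  la : Y l ≤ Y a
  lb : Y l ≤ Y b
  ah : X a ≤ X h
  al : X a ≤ X l
  hlt : X h < X b
  llt : X l < X b
  he : X h ≤ e
  le : X l ≤ e
  eb : e ≤ X b
  eh : e - (Y h - Y l) ≤ X h
  el : e - (Y h - Y l) ≤ X l
  empty : EmptySquare X Y (e - (Y h - Y l)) (Y l) (Y h - Y l)
  wh : Within X Y K a h dh
  wl : Within X Y K a l dl
  bh : dh ≤ (1 + K) * (X h - X a) + (Y h - Y a)
  bl : dl ≤ (1 + K) * (X l - X a) + (Y a - Y l)
  potential : dh + dl ≤ 2 * (e - X a) + (X h - X a) + (X l - X a) - (Y h - Y l)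

/-- Reflection in a horizontal axis exchanges the two ends, and the potential is symmetric in them.
Cases in which the lower end moves thus reduce to cases in which the upper end does. -/
theorem Ladder.mirror {e dh dl : ℝ} (H : Ladder X Y K a b h l e dh dl) :
    Ladder X (fun i => -Y i) K a b l h e dl dh where
  ha := neg_le_neg H.la
  hb := neg_le_neg H.lb
  la := neg_le_neg H.ha
  lb := neg_le_neg H.hb
  ah := H.al
  al := H.ah
  hlt := H.llt
  llt := H.hlt
  he := H.le
  le := H.he
  eb := H.eb
  eh := by have := H.el; linarith
  el := by have := H.eh; linarith
  empty := H.empty.neg_right.mono (by linarith) (by linarith) (by linarith) (by linarith)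
  wh := H.wl.neg_right
  wl := H.wh.neg_right
  bh := by have := H.bl; linarith
  bl := by have := H.bh; linarith
  potential := by have := H.potential; linarith

theorem Ladder.of_mirror {e dh dl : ℝ} (H : Ladder X (fun i => -Y i) K a b h l e dh dl) :
    Ladder X Y K a b l h e dl dh := by
  simpa using H.mirror

/-- The hypotheses on `a` and `b` under which the ladder is climbed: the rectangle that they span
is empty, and gentle pairs to the right of `a` are already known to be close. -/
structure Setting (X Y : ι → ℝ) (K : ℝ) (a b : ι) : Prop where
  injX : Function.Injective X
  injY : Function.Injective Y
  one_le : 1 ≤ K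
  le_two : K ≤ 2
  lt : X a < X b
  gentle : |Y b - Y a| ≤ X b - X a
  rect : ∀ z, z ≠ b → X a < X z → X z ≤ X b → (Y z < Y a ∧ Y z < Y b) ∨ (Y a < Y z ∧ Y b < Y z)
  close : ∀ u, X a < X u → X u ≤ X b → |Y u - Y b| ≤ X b - X u →
    Within X Y K u b ((1 + K) * (X b - X u) + |Y u - Y b|)

theorem Setting.mirror (S : Setting X Y K a b) : Setting X (fun i => -Y i) K a b where
  injX := S.injX
  injY := fun _ _ h => S.injY (neg_injective h)
  one_le := S.one_le
  le_two := S.le_two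
  lt := S.lt
  gentle := by
    have := S.gentle
    rwa [show -Y b - -Y a = -(Y b - Y a) by ring, abs_neg]
  rect := fun z h1 h2 h3 => by
    have := S.rect z h1 h2 h3
    simp only [neg_lt_neg_iff]
    tauto
  close := fun u h1 h2 h3 => by
    rw [show -Y u - -Y b = -(Y u - Y b) by ring, abs_neg] at h3 ⊢
    exact (S.close u h1 h2 h3).neg_right

/-- The bound aimed at for a gentle pair. -/
def Bounded (X Y : ι → ℝ) (K : ℝ) (a b : ι) : Prop :=
  Within X Y K a b ((1 + K) * (X b - X a) + |Y b - Y a|)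

theorem Bounded.of_mirror (H : Bounded X (fun i => -Y i) K a b) : Bounded X Y K a b := by
  unfold Bounded at H
  rw [show -Y b - -Y a = -(Y b - Y a) by ring, abs_neg] at H
  exact H.of_neg_right

/-- A growing empty square through `h` and `l` meets the point `c` with its right side, above the
rectangle or at `b`. -/
theorem Setting.right_hit [Finite ι] (S : Setting X Y K a b) {dh dl B w : ℝ}
    (hca : X c ≤ X b) (la : Y l ≤ Y a) (lb : Y l ≤ Y b) (hlc : Y l < Y c)
    (hc : c ≠ b → Y a ≤ Y c ∧ Y b < Y c)
    (hlh : Y l ≤ Y h) (hBl : B ≤ Y l) (hhB : Y h ≤ B + w) (hcB : Y c ≤ B + w)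
    (hwh : X c - w ≤ X h) (hwl : X c - w ≤ X l) (hhc : X h < X c) (hlc' : X l < X c)
    (ah : X a ≤ X h) (al : X a ≤ X l)
    (hE : EmptySquare X Y (X c - w) B w)
    (wh : Within X Y K a h dh) (wl : Within X Y K a l dl)
    (bl : dl ≤ (1 + K) * (X l - X a) + (Y a - Y l))
    (pot : dh + dl ≤ 2 * (X c - X a) + (X h - X a) + (X l - X a) + (Y h - Y l) - 2 * w) :
    Bounded X Y K a b ∨ ∃ dc, Ladder X Y K a b c l (X c) dc dl := by
  have hK1 := S.one_le
  have hK2 := S.le_two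
  have hadj1 : SquareAdj X Y h c :=
    ⟨by rintro rfl; linarith, _, _, _, by linarith,
      ⟨hwh, by linarith, by linarith, hhB⟩, ⟨by linarith, by linarith, by linarith, hcB⟩, hE⟩
  have hadj2 : SquareAdj X Y l c :=
    ⟨by rintro rfl; linarith, _, _, _, by linarith,
      ⟨hwl, by linarith, by linarith, by linarith⟩,
      ⟨by linarith, by linarith, by linarith, hcB⟩, hE⟩
  have w1 := wh.trans (hadj1.within_add hK2)
  have w2 := wl.trans (hadj2.within_add hK2)
  rw [abs_of_neg (by linarith : X h - X c < 0)] at w1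
  rw [abs_of_neg (by linarith : X l - X c < 0), abs_of_neg (by linarith : Y l - Y c < 0)] at w2
  -- This is the potential of the pair `(c, l)` with `c` reached through `h`. It uses that both `h`
  -- and `c` are at height at most `Y l + w`.
  have p1 : (dh + (-(X h - X c) + |Y h - Y c|)) + dl ≤
      2 * (X c - X a) + (X c - X a) + (X l - X a) - (Y c - Y l) := by
    rcases abs_cases (Y h - Y c) with ⟨h1, -⟩ | ⟨h1, -⟩ <;> rw [h1] <;> linarith
  -- The shorter of the routes through `h` and `l` is taken. It is at most their average, `2 * (X c
  -- - X a)`, and `p1` persists because the route chosen is no longer than the one through `h`.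
  obtain ⟨dc, wc, h1, h2⟩ : ∃ dc, Within X Y K a c dc ∧ dc ≤ 2 * (X c - X a) ∧
      dc + dl ≤ 2 * (X c - X a) + (X c - X a) + (X l - X a) - (Y c - Y l) := by
    rcases le_total (dh + (-(X h - X c) + |Y h - Y c|)) (dl + (-(X l - X c) + -(Y l - Y c)))
      with h1 | h1
    · exact ⟨_, w1, by linarith, by linarith⟩
    · exact ⟨_, w2, by linarith, by linarith⟩
  have hac : X a < X c := by linarith
  rcases eq_or_ne c b with rfl | hcb
  · refine Or.inl (wc.mono ?_)
    have := abs_nonneg (Y c - Y a)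
    nlinarith
  obtain ⟨ca, cb⟩ := hc hcb
  have hltb : X c < X b := lt_of_le_of_ne hca fun h => hcb (S.injX h)
  rcases le_or_gt (Y c - Y l) (X c - X l) with hg | hg
  · left
    -- Here the octagonal length of a gentle edge is essential: with `Y c - Y l` still to be
    -- absorbed, the total is `(X c - X l) + K * (Y c - Y l) ≤ (1 + K) * (X c - X l)`.
    have w3 := wl.trans hadj2.within
    rw [octNorm_of_le (by rw [abs_of_neg (by linarith), abs_of_neg (by linarith)]; linarith),
      abs_of_neg (by linarith : X l - X c < 0), abs_of_neg (by linarith : Y l - Y c < 0)] at w3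
    have w4 := within_of_emptySquare_left S.injX S.injY hK1 hK2 S.close c hac hltb cb (X c)
      le_rfl hca (by linarith)
      (hE.mono (by linarith) (by linarith) (by linarith) (by linarith))
    refine (w3.trans w4).mono ?_
    have := neg_abs_le (Y b - Y a)
    nlinarith
  · right
    exact ⟨dc,
      { ha := ca, hb := cb.le, la := la, lb := lb, ah := hac.le, al := al, hlt := hltb
        llt := by linarith
        he := le_rfl, le := hlc'.le, eb := hca, eh := by linarith, el := by linarith
        empty := hE.mono (by linarith) hBl (by linarith) (by linarith)
        wh := wc, wl := wl, bh := by nlinarith, bl := bl, potential := by linarith }⟩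

/-- An empty square with `h` at its upper left corner and `l` on its lower side grows from its
lower left corner. -/
theorem Setting.corner_growth [Finite ι] (S : Setting X Y K a b) {dh dl : ℝ}
    (la : Y l ≤ Y a) (lb : Y l < Y b) (hlh : Y l ≤ Y h) (hhl : X h ≤ X l)
    (hup : (Y a ≤ Y h ∧ Y b ≤ Y h) ∨ Y l = Y a)
    (hlv : X l ≤ X h + (Y h - Y l)) (hvb : X h + (Y h - Y l) ≤ X b)
    (hb : Y b - Y l ≤ X b - X h) (hhb : X h < X b) (hltb : X l < X b)
    (ah : X a ≤ X h)
    (hE : EmptySquare X Y (X h) (Y l) (Y h - Y l))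
    (wh : Within X Y K a h dh) (wl : Within X Y K a l dl)
    (bh : dh ≤ (1 + K) * (X h - X a) + (Y h - Y a))
    (bl : dl ≤ (1 + K) * (X l - X a) + (Y a - Y l))
    (pot : dh + dl ≤ 2 * (X h + (Y h - Y l) - X a) + (X h - X a) + (X l - X a) - (Y h - Y l)) :
    Bounded X Y K a b ∨ ∃ h' l' e' dh' dl', Ladder X Y K a b h' l' e' dh' dl' ∧
      X h + X l < X h' + X l' := by
  have hK1 := S.one_le
  have hK2 := S.le_two
  -- The point `b` lies in the quadrant, and its direction from the corner is gentle. The growth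
  -- therefore stops before the right side passes `b`.
  obtain ⟨c, hc1, hc2, hcb, hEc⟩ := exists_first_in_quadrant X Y hhb lb
  rw [max_eq_left hb] at hcb
  have hv : Y h - Y l ≤ max (X c - X h) (Y c - Y l) := by
    by_contra! hlt
    rw [max_lt_iff] at hlt
    exact hE c hc1 (by linarith) hc2 (by linarith)
  have hXcb : X c ≤ X b := by linarith [le_max_left (X c - X h) (Y c - Y l)]
  have hrect : c ≠ b → (Y c < Y a ∧ Y c < Y b) ∨ (Y a < Y c ∧ Y b < Y c) :=
    fun h => S.rect c h (by linarith) hXcb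
  -- The growing square meets `c` with its right side or with its top. While it grows, `h` stays on
  -- its left side and `l` on its lower side.
  rcases le_or_gt (Y c - Y l) (X c - X h) with hg | hg
  · rw [max_eq_left hg] at hEc hv hcb
    have hlc : X l < X c := by
      refine lt_of_le_of_ne (by linarith) fun h => ?_
      rw [S.injX h] at hc2
      exact lt_irrefl _ hc2
    have hEc' : EmptySquare X Y (X c - (X c - X h)) (Y l) (X c - X h) :=
      hEc.mono (by linarith) le_rfl (by linarith) le_rfl
    by_cases hbelow : c ≠ b ∧ Y c < Y a ∧ Y c < Y b
    · obtain ⟨hne, hca', hcb'⟩ := hbelow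
      -- If `l` is at the height of `a`, no point of the square is below `a`.
      have hup' : Y a ≤ Y h ∧ Y b ≤ Y h := hup.resolve_right fun h => by linarith
      rcases S.mirror.right_hit (h := l) (l := h) (c := c) (dh := dl) (dl := dh)
        (B := -(Y l + (X c - X h))) (w := X c - X h) hXcb (by linarith) (by linarith)
        (by linarith) (fun _ => ⟨by linarith, by linarith⟩) (by linarith)
        (by linarith) (by linarith) (by linarith) (by linarith) (by linarith) hlc
        (by linarith) (by linarith) ah hEc'.neg_right wl.neg_right wh.neg_right (by linarith)
        (by linarith) with H | ⟨dc, H⟩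
      · exact Or.inl H.of_mirror
      · exact Or.inr ⟨h, c, _, _, _, H.of_mirror, by linarith⟩
    · rcases S.right_hit (h := h) (l := l) (c := c) (dh := dh) (dl := dl)
        (B := Y l) (w := X c - X h) hXcb la lb.le hc2
        (fun hne => by
          rcases hrect hne with h1 | h1
          · exact absurd ⟨hne, h1⟩ hbelow
          · exact ⟨h1.1.le, h1.2⟩)
        hlh le_rfl (by linarith) (by linarith) (by linarith) (by linarith) hc1 hlc ah
        (by linarith) hEc' wh wl bl (by linarith) with H | ⟨dc, H⟩
      · exact Or.inl H
      · exact Or.inr ⟨c, l, _, _, _, H, by linarith⟩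
  · rw [max_eq_right hg.le] at hEc hv hcb
    have hne : c ≠ b := by rintro rfl; linarith
    have hXcb' : X c < X b := lt_of_le_of_ne hXcb fun h => hne (S.injX h)
    have hYa : Y a < Y c ∧ Y b < Y c := by
      rcases hrect hne with h1 | h1
      · exfalso
        rcases hup with h2 | h2 <;> linarith
      · exact h1
    have hadj : SquareAdj X Y h c :=
      ⟨by rintro rfl; exact lt_irrefl _ hc1, X h, Y l, Y c - Y l, by linarith,
        ⟨le_rfl, by linarith, by linarith, by linarith⟩,
        ⟨by linarith, by linarith, by linarith, by linarith⟩, hEc⟩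
    have w1 := wh.trans (hadj.within_add hK2)
    rw [abs_of_neg (by linarith : X h - X c < 0), abs_of_nonpos (by linarith)] at w1
    -- The top moves `h` to `c`. The side grows by `Y c - Y h`, which raises the term `2 * e` of the
    -- potential by twice that amount: once for the vertical part of the new edge, once for the
    -- larger height of the pair.
    refine Or.inr ⟨c, l, X h + (Y c - Y l), _, dl,
      { ha := hYa.1.le, hb := hYa.2.le, la := la, lb := lb.le, ah := by linarith
        al := by linarith, hlt := hXcb', llt := hltb, he := by linarith, le := by linarith
        eb := by linarith, eh := by linarith, el := by linarith
        empty := hEc.mono (by linarith) le_rfl (by linarith) le_rfl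
        wh := w1, wl := wl, bh := by nlinarith, bl := bl, potential := by linarith }, by linarith⟩

/-- The square slides right with `h` on its upper and `l` on its lower side. Either its right side
meets a point, or its left side first reaches the leftmost of `h` and `l`; that end is then a corner
and `corner_growth` takes over. Sliding only weakens the potential bound, which increases with `e`.
-/
theorem Ladder.step [Finite ι] (S : Setting X Y K a b) {e dh dl : ℝ}
    (H : Ladder X Y K a b h l e dh dl) :
    Bounded X Y K a b ∨ ∃ h' l' e' dh' dl', Ladder X Y K a b h' l' e' dh' dl' ∧
      X h + X l < X h' + X l' := by
  have hlb : Y l < Y b :=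
    lt_of_le_of_ne H.lb fun h => by have := H.llt; rw [S.injY h] at this; exact lt_irrefl _ this
  have hbh : Y b < Y h :=
    lt_of_le_of_ne H.hb fun h => by have := H.hlt; rw [S.injY h] at this; exact lt_irrefl _ this
  obtain ⟨ha, hb, la, lb, ah, al, hlt, llt, he, le, eb, eh, el, empty, wh, wl, bh, bl, pot⟩ := H
  obtain ⟨c, hec, hcb, hlc, hch, hE⟩ :=
    exists_first_in_strip X Y (b := b) eb hlb (by linarith) empty
  -- The threshold is the position of the right side when the left side reaches the leftmost end.
  rcases le_or_gt (X c) (min (X h) (X l) + (Y h - Y l)) with hm | hm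
  · have hm1 := min_le_left (X h) (X l)
    have hm2 := min_le_right (X h) (X l)
    have hE' := hE (X c) hec le_rfl
    have hhc : X h < X c := lt_of_le_of_ne (by linarith) fun h => by
      rw [S.injX h] at hch; linarith
    have hlc' : X l < X c := lt_of_le_of_ne (by linarith) fun h => by
      rw [S.injX h] at hlc; linarith
    by_cases hbelow : c ≠ b ∧ Y c < Y a ∧ Y c < Y b
    · obtain ⟨hne, hca', hcb'⟩ := hbelow
      rcases S.mirror.right_hit (h := l) (l := h) (c := c) (dh := dl) (dl := dh)
        (B := -(Y l + (Y h - Y l))) (w := Y h - Y l) hcb (by linarith) (by linarith)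
        (by linarith) (fun _ => ⟨by linarith, by linarith⟩) (by linarith)
        (by linarith) (by linarith) (by linarith) (by linarith) (by linarith) hlc'
        hhc al ah hE'.neg_right wl.neg_right wh.neg_right (by linarith)
        (by linarith) with H | ⟨dc, H⟩
      · exact Or.inl H.of_mirror
      · exact Or.inr ⟨h, c, _, _, _, H.of_mirror, by linarith⟩
    · rcases S.right_hit (h := h) (l := l) (c := c) (dh := dh) (dl := dl)
        (B := Y l) (w := Y h - Y l) hcb la lb hlc
        (fun hne => by
          rcases S.rect c hne (by linarith) hcb with h1 | h1
          · exact absurd ⟨hne, h1⟩ hbelow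
          · exact ⟨h1.1.le, h1.2⟩)
        (by linarith) le_rfl (by linarith) (by linarith) (by linarith) (by linarith) hhc hlc' ah
        al hE' wh wl bl (by linarith) with H | ⟨dc, H⟩
      · exact Or.inl H
      · exact Or.inr ⟨c, l, _, _, _, H, by linarith⟩
  · rcases le_total (X h) (X l) with hhl | hhl
    · rw [min_eq_left hhl] at hm
      have hE' := hE (X h + (Y h - Y l)) (by linarith) hm.le
      exact S.corner_growth la hlb (by linarith) hhl (Or.inl ⟨ha, hb⟩) (by linarith)
        (by linarith) (by linarith) hlt llt ah
        (hE'.mono (by linarith) le_rfl (by linarith) le_rfl) wh wl bh bl (by linarith)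
    · rw [min_eq_right hhl] at hm
      have hE' := hE (X l + (Y h - Y l)) (by linarith) hm.le
      rcases S.mirror.corner_growth (h := l) (l := h) (dh := dl) (dl := dh) (by linarith)
        (by linarith) (by linarith) hhl (Or.inl ⟨by linarith, by linarith⟩) (by linarith)
        (by linarith) (by linarith) llt hlt al
        (hE'.neg_right.mono (by linarith) (by linarith) (by linarith) (by linarith))
        wl.neg_right wh.neg_right (by linarith) (by linarith) (by linarith)
        with H | ⟨h', l', e', dh', dl', H, hlt'⟩
      · exact Or.inl H.of_mirror
      · exact Or.inr ⟨l', h', e', _, _, H.of_mirror, by linarith⟩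

theorem Ladder.bounded [Finite ι] (S : Setting X Y K a b) {e dh dl : ℝ}
    (H : Ladder X Y K a b h l e dh dl) : Bounded X Y K a b := by
  suffices ∀ p : ι × ι, ∀ e dh dl, Ladder X Y K a b p.1 p.2 e dh dl → Bounded X Y K a b from
    this (h, l) e dh dl H
  intro p
  induction p using (wellFounded_gt_comp fun p : ι × ι => X p.1 + X p.2).induction with
  | _ p ih =>
  intro e dh dl H
  rcases H.step S with h1 | ⟨h', l', e', dh', dl', H', hlt⟩
  · exact h1
  · exact ih (h', l') hlt _ _ _ H'

/-- The start is a degenerate square of side zero at `a`, with both ends equal to `a` and trivial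
walks, grown from its lower left corner. -/
theorem Setting.bounded [Finite ι] (S : Setting X Y K a b) (hab : Y a < Y b) :
    Bounded X Y K a b := by
  have hg := S.gentle
  have hlt := S.lt
  rw [abs_of_pos (by linarith)] at hg
  rcases S.corner_growth (h := a) (l := a) (dh := 0) (dl := 0) le_rfl hab le_rfl le_rfl
    (Or.inr rfl) (by linarith) (by linarith) hg hlt hlt le_rfl
    (fun z _ _ h1 h2 => by linarith) (.refl _ _ le_rfl) (.refl _ _ le_rfl) (by linarith)
    (by linarith) (by linarith) with H | ⟨_, _, _, _, _, H, -⟩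
  · exact H
  · exact H.bounded S

/-! ### Induction over all pairs. -/

/-- The distance bound, for gentle and for steep pairs. -/
def Good (X Y : ι → ℝ) (K : ℝ) (a b : ι) : Prop :=
  Within X Y K a b ((1 + K) * max |X a - X b| |Y a - Y b| + min |X a - X b| |Y a - Y b|)

theorem Good.swap (H : Good X Y K a b) : Good Y X K a b := by
  unfold Good
  rw [max_comm, min_comm]
  exact Within.swap H

theorem Good.neg_right (H : Good X Y K a b) : Good X (fun i => -Y i) K a b := by
  unfold Good
  rw [show -Y a - -Y b = -(Y a - Y b) by ring, abs_neg]
  exact Within.neg_right H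

theorem Good.of_neg_right (H : Good X (fun i => -Y i) K a b) : Good X Y K a b := by
  simpa using H.neg_right

theorem Good.neg_left (H : Good X Y K a b) : Good (fun i => -X i) Y K a b :=
  H.swap.neg_right.swap

theorem Good.of_neg_left (H : Good (fun i => -X i) Y K a b) : Good X Y K a b :=
  H.swap.of_neg_right.swap

theorem Good.symm (H : Good X Y K a b) : Good X Y K b a := by
  unfold Good
  rw [abs_sub_comm (X b), abs_sub_comm (Y b)]
  exact Within.symm H

theorem Good.within_of_gentle (H : Good X Y K a b) (h : |Y a - Y b| ≤ |X a - X b|) :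
    Within X Y K a b ((1 + K) * |X a - X b| + |Y a - Y b|) := by
  rwa [Good, max_eq_left h, min_eq_right h] at H

/-- The case of a point in the rectangle spanned by a gentle pair that is steep from `a`. -/
theorem good_of_steep_point [Finite ι] (hK1 : 1 ≤ K) (hK2 : K ≤ 2) (hg : Y b - Y a ≤ X b - X a)
    (IH : ∀ u, X a < X u → X u ≤ X b → Y a < Y u → Y u ≤ Y b → Good X Y K u b)
    (hac : X a < X c) (hac' : Y a < Y c) (hcb : Y c ≤ Y b) (hs : X c - X a ≤ Y c - Y a) :
    Good X Y K a b := by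
  obtain ⟨d, hd1, hd2, hd3, hE⟩ := exists_first_in_quadrant X Y hac hac'
  rw [max_eq_right hs] at hd3
  have hd4 := le_max_left (X d - X a) (Y d - Y a)
  have hd5 := le_max_right (X d - X a) (Y d - Y a)
  have hadj : SquareAdj X Y a d :=
    ⟨by rintro rfl; exact lt_irrefl _ hd1, X a, Y a, _, by linarith,
      ⟨le_rfl, by linarith, le_rfl, by linarith⟩,
      ⟨by linarith, by linarith, by linarith, by linarith⟩, hE⟩
  have hw := hadj.within_add hK2
  refine (hw.trans (IH d hd1 (by linarith) hd2 (by linarith))).mono ?_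
  rw [abs_of_neg (by linarith : X a - X d < 0), abs_of_neg (by linarith : Y a - Y d < 0),
    abs_of_nonpos (by linarith : X d - X b ≤ 0), abs_of_nonpos (by linarith : Y d - Y b ≤ 0),
    abs_of_nonpos (by linarith : X a - X b ≤ 0), abs_of_nonpos (by linarith : Y a - Y b ≤ 0),
    max_eq_left (by linarith : -(Y a - Y b) ≤ -(X a - X b)),
    min_eq_right (by linarith : -(Y a - Y b) ≤ -(X a - X b))]
  -- If the remaining pair is steep, its larger term `(1 + K) * (Y b - Y d)` is affordable because
  -- `Y b - Y a ≤ X b - X a`.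
  rcases le_total (-(X d - X b)) (-(Y d - Y b)) with h | h
  · rw [max_eq_right h, min_eq_left h]
    nlinarith
  · rw [max_eq_left h, min_eq_right h]
    nlinarith

/-- A point `c` of the rectangle that is gentle from both `a` and `b` makes the two bounds add up
exactly. If it is steep from one of them, `good_of_steep_point` applies, after a half turn when that
end is `b`. An empty rectangle is the ladder case. -/
theorem good_of_rect [Finite ι] (hX : Function.Injective X) (hY : Function.Injective Y)
    (hK1 : 1 ≤ K) (hK2 : K ≤ 2) (hXab : X a < X b) (hYab : Y a < Y b)
    (hg : Y b - Y a ≤ X b - X a)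
    (IH : ∀ u v, X a ≤ X u → X u < X v → X v ≤ X b → |Y u - Y v| < X b - X a →
      X v - X u < X b - X a → Good X Y K u v) :
    Good X Y K a b := by
  by_cases hc : ∃ c, c ≠ b ∧ X a < X c ∧ X c ≤ X b ∧ Y a ≤ Y c ∧ Y c ≤ Y b
  · obtain ⟨c, hne, h1, h2, h3, h4⟩ := hc
    have h2' : X c < X b := lt_of_le_of_ne h2 fun h => hne (hX h)
    have h3' : Y a < Y c := lt_of_le_of_ne h3 fun h => by
      rw [hY h] at h1; exact lt_irrefl _ h1
    have h4' : Y c < Y b := lt_of_le_of_ne h4 fun h => hne (hY h)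
    rcases le_total (X c - X a) (Y c - Y a) with h5 | h5
    · refine good_of_steep_point hK1 hK2 hg (fun u hu1 hu2 hu3 hu4 => ?_) h1 h3' h4 h5
      rcases eq_or_ne u b with rfl | hub
      · exact .refl _ _ (by simp)
      · refine IH u b hu1.le (lt_of_le_of_ne hu2 fun h => hub (hX h)) le_rfl ?_ (by linarith)
        rw [abs_of_nonpos (by linarith)]
        linarith
    rcases le_total (X b - X c) (Y b - Y c) with h6 | h6
    · have : Good (fun i => -X i) (fun i => -Y i) K b a := by
        refine good_of_steep_point (c := c) hK1 hK2 (by linarith)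
          (fun u hu1 hu2 hu3 hu4 => ?_) (by linarith) (by linarith) (by linarith)
          (by linarith)
        rcases eq_or_ne u a with rfl | hua
        · exact .refl _ _ (by simp)
        · refine (IH a u le_rfl (lt_of_le_of_ne (by linarith) fun h => hua (hX h).symm)
            (by linarith) ?_ (by linarith)).symm.neg_left.neg_right
          rw [abs_of_nonpos (by linarith)]
          linarith
      exact this.of_neg_left.of_neg_right.symm
    · have w1 := (IH a c le_rfl h1 h2 (by rw [abs_of_neg (by linarith)]; linarith)
        (by linarith)).within_of_gentle
        (by rw [abs_of_neg (by linarith), abs_of_neg (by linarith)]; linarith)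
      have w2 := (IH c b h1.le h2' le_rfl (by rw [abs_of_neg (by linarith)]; linarith)
        (by linarith)).within_of_gentle
        (by rw [abs_of_neg (by linarith), abs_of_neg (by linarith)]; linarith)
      refine (w1.trans w2).mono ?_
      rw [abs_of_neg (by linarith : X a - X c < 0), abs_of_neg (by linarith : Y a - Y c < 0),
        abs_of_neg (by linarith : X c - X b < 0), abs_of_neg (by linarith : Y c - Y b < 0),
        abs_of_neg (by linarith : X a - X b < 0), abs_of_neg (by linarith : Y a - Y b < 0),
        max_eq_left (by linarith : -(Y a - Y b) ≤ -(X a - X b)),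
        min_eq_right (by linarith : -(Y a - Y b) ≤ -(X a - X b))]
      exact le_of_eq (by ring)
  · push Not at hc
    have S : Setting X Y K a b :=
      { injX := hX, injY := hY, one_le := hK1, le_two := hK2, lt := hXab
        gentle := by rwa [abs_of_pos (by linarith)]
        rect := fun z h1 h2 h3 => by
          rcases lt_or_ge (Y z) (Y a) with h4 | h4
          · exact Or.inl ⟨h4, by linarith⟩
          · have := hc z h1 h2 h3 h4
            exact Or.inr ⟨by linarith, this⟩
        close := fun u h1 h2 h3 => by
          rcases eq_or_ne u b with rfl | hub
          · exact .refl _ _ (by simp)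
          · have h4 : X u < X b := lt_of_le_of_ne h2 fun h => hub (hX h)
            have := (IH u b h1.le h4 le_rfl (by linarith) (by linarith)).within_of_gentle
              (by rwa [abs_of_neg (by linarith : X u - X b < 0), neg_sub])
            rwa [abs_of_neg (by linarith : X u - X b < 0), neg_sub] at this }
    have := S.bounded hYab
    unfold Bounded at this
    rw [Good, abs_sub_comm (X a), abs_sub_comm (Y a), abs_of_pos (by linarith : 0 < X b - X a),
      max_eq_left (by rwa [abs_of_pos (by linarith)]),
      min_eq_right (by rwa [abs_of_pos (by linarith)])]
    exact this

/-- The induction is on the maximum of the coordinate differences. That quantity and the bound are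
invariant under swapping the axes and under reflections, which gives the normal position. -/
theorem good [Finite ι] (hX : Function.Injective X) (hY : Function.Injective Y)
    (hK1 : 1 ≤ K) (hK2 : K ≤ 2) (a b : ι) : Good X Y K a b := by
  suffices ∀ p : ι × ι, Good X Y K p.1 p.2 from this (a, b)
  intro p
  induction p using (wellFounded_gt_comp fun p : ι × ι =>
    -max |X p.1 - X p.2| |Y p.1 - Y p.2|).induction with
  | _ p ih =>
  obtain ⟨a, b⟩ := p
  have IH : ∀ u v, max |X u - X v| |Y u - Y v| < max |X a - X b| |Y a - Y b| →
      Good X Y K u v := fun u v h => ih (u, v) (neg_lt_neg h)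
  clear ih
  rcases eq_or_ne a b with rfl | hab
  · exact .refl _ _ (by simp)
  wlog hg : |Y a - Y b| ≤ |X a - X b| generalizing X Y
  · refine (this hY hX (fun u v h => (IH u v ?_).swap) (le_of_not_ge hg)).swap
    rwa [max_comm, max_comm |X a - X b|]
  wlog hx : X a < X b generalizing X
  · have e : ∀ u v, |-X u - -X v| = |X u - X v| := fun u v => by
      rw [show -X u - -X v = -(X u - X v) by ring, abs_neg]
    refine (this (X := fun i => -X i) (fun _ _ h => hX (neg_injective h))
      (fun u v h => (IH u v ?_).neg_left) ?_ ?_).of_neg_left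
    · simpa only [e] using h
    · simpa only [e] using hg
    · exact neg_lt_neg (lt_of_le_of_ne (not_lt.1 hx) fun h => hab (hX h).symm)
  wlog hy : Y a < Y b generalizing Y
  · have e : ∀ u v, |-Y u - -Y v| = |Y u - Y v| := fun u v => by
      rw [show -Y u - -Y v = -(Y u - Y v) by ring, abs_neg]
    refine (this (Y := fun i => -Y i) (fun _ _ h => hY (neg_injective h))
      (fun u v h => (IH u v ?_).neg_right) ?_ ?_).of_neg_right
    · simpa only [e] using h
    · simpa only [e] using hg
    · exact neg_lt_neg (lt_of_le_of_ne (not_lt.1 hy) fun h => hab (hY h).symm)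
  rw [max_eq_left hg, abs_of_neg (by linarith)] at IH
  rw [abs_of_neg (by linarith), abs_of_neg (by linarith)] at hg
  refine good_of_rect hX hY hK1 hK2 hx hy (by linarith) fun u v h1 h2 h3 h4 h5 =>
    IH u v (max_lt ?_ (by linarith))
  rw [abs_of_neg (by linarith)]
  linarith

end

/-! ### Coordinates that turn the parallelogram into a unit square. -/

/-- Coordinate of a point along the short side, in units of its length. -/
noncomputable def shortCoord (s θ₀ : ℝ) (z : Plane) : ℝ := z 0 / (s * Real.sin θ₀)

/-- Coordinate of a point along the long side, in units of its length. -/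
noncomputable def longCoord (l θ₀ : ℝ) (z : Plane) : ℝ :=
  (z 1 - z 0 * Real.cos θ₀ / Real.sin θ₀) / l

section

variable {l s θ₀ : ℝ}

theorem eq_coords (hl : l ≠ 0) (hs : s ≠ 0) (hθ : Real.sin θ₀ ≠ 0) (z : Plane) :
    z = longCoord l θ₀ z • l • longDir + shortCoord s θ₀ z • s • shortDir θ₀ := by
  ext i
  fin_cases i
  · simp [shortCoord, longDir, shortDir]
    field_simp
  · simp [longCoord, shortCoord, longDir, shortDir]
    field_simp
    ring

theorem mem_scaledTranslate (hl : l ≠ 0) (hs : s ≠ 0) (hθ : Real.sin θ₀ ≠ 0) {p q w : ℝ}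
    (hw : 0 < w) {z : Plane} (h1 : p ≤ shortCoord s θ₀ z) (h2 : shortCoord s θ₀ z ≤ p + w)
    (h3 : q ≤ longCoord l θ₀ z) (h4 : longCoord l θ₀ z ≤ q + w) :
    z ∈ scaledTranslate (parallelogram l s θ₀) (q • l • longDir + p • s • shortDir θ₀) w := by
  refine ⟨((longCoord l θ₀ z - q) / w) • l • longDir +
    ((shortCoord s θ₀ z - p) / w) • s • shortDir θ₀, ?_, ?_⟩
  · rw [parallelogram, mem_parallelepiped_iff]
    refine ⟨![(longCoord l θ₀ z - q) / w, (shortCoord s θ₀ z - p) / w], ⟨?_, ?_⟩, by simp⟩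
    · intro i
      fin_cases i
      · exact div_nonneg (by linarith) hw.le
      · exact div_nonneg (by linarith) hw.le
    · intro i
      fin_cases i
      · exact (div_le_one hw).2 (by linarith)
      · exact (div_le_one hw).2 (by linarith)
  · conv_rhs => rw [eq_coords hl hs hθ z]
    simp only [smul_add, smul_smul, mul_div_cancel₀ _ hw.ne', ← mul_assoc]
    module

theorem longCoord_combination (hl : l ≠ 0) (hθ : Real.sin θ₀ ≠ 0) (p q : ℝ) :
    longCoord l θ₀ (q • l • longDir + p • s • shortDir θ₀) = q := by
  simp [longCoord, longDir, shortDir]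
  field_simp
  ring

theorem shortCoord_combination (hs : s ≠ 0) (hθ : Real.sin θ₀ ≠ 0) (p q : ℝ) :
    shortCoord s θ₀ (q • l • longDir + p • s • shortDir θ₀) = p := by
  simp [shortCoord, longDir, shortDir]
  field_simp

theorem coords_of_mem_scaledTranslate (hl : l ≠ 0) (hs : s ≠ 0) (hθ : Real.sin θ₀ ≠ 0)
    {p q w : ℝ} (hw : 0 < w) {z : Plane}
    (hz : z ∈ scaledTranslate (parallelogram l s θ₀)
      (q • l • longDir + p • s • shortDir θ₀) w) :
    shortCoord s θ₀ z ∈ Set.Icc p (p + w) ∧ longCoord l θ₀ z ∈ Set.Icc q (q + w) := by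
  obtain ⟨y, hy, rfl⟩ := hz
  rw [parallelogram, mem_parallelepiped_iff] at hy
  obtain ⟨t, ⟨ht0, ht1⟩, rfl⟩ := hy
  have h0 : 0 ≤ t 0 := ht0 0
  have h1 : 0 ≤ t 1 := ht0 1
  have h2 : t 0 ≤ 1 := ht1 0
  have h3 : t 1 ≤ 1 := ht1 1
  have e : (q • l • longDir + p • s • shortDir θ₀) +
      w • ∑ i, t i • ![l • longDir, s • shortDir θ₀] i =
      (q + w * t 0) • l • longDir + (p + w * t 1) • s • shortDir θ₀ := by
    simp only [Fin.sum_univ_two, Matrix.cons_val_zero, Matrix.cons_val_one]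
    module
  simp only [e]
  rw [shortCoord_combination hs hθ, longCoord_combination hl hθ]
  refine ⟨⟨?_, ?_⟩, ?_, ?_⟩ <;> nlinarith

theorem isOpenMap_shortCoord (hs : s ≠ 0) (hθ : Real.sin θ₀ ≠ 0) :
    IsOpenMap (shortCoord s θ₀) := by
  let f : Plane →ₗ[ℝ] ℝ :=
    { toFun := shortCoord s θ₀
      map_add' := fun x y => by simp [shortCoord]; ring
      map_smul' := fun c x => by simp [shortCoord]; ring }
  exact f.isOpenMap_of_finiteDimensional fun r =>
    ⟨(0 : ℝ) • (1 : ℝ) • longDir + r • s • shortDir θ₀, shortCoord_combination hs hθ r 0⟩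

theorem isOpenMap_longCoord (hl : l ≠ 0) (hθ : Real.sin θ₀ ≠ 0) :
    IsOpenMap (longCoord l θ₀) := by
  let f : Plane →ₗ[ℝ] ℝ :=
    { toFun := longCoord l θ₀
      map_add' := fun x y => by simp [longCoord]; ring
      map_smul' := fun c x => by simp [longCoord]; ring }
  exact f.isOpenMap_of_finiteDimensional fun r =>
    ⟨r • l • longDir + (0 : ℝ) • (1 : ℝ) • shortDir θ₀, longCoord_combination hl hθ 0 r⟩

theorem _root_.IsOpenMap.mem_Ioo_of_mem_interior {E : Type*} [TopologicalSpace E] {f : E → ℝ}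
    (hf : IsOpenMap f) {S : Set E} {x y : ℝ} (hS : ∀ z ∈ S, f z ∈ Set.Icc x y) {z : E}
    (hz : z ∈ interior S) : f z ∈ Set.Ioo x y := by
  rw [← interior_Icc]
  have : f '' S ⊆ Set.Icc x y := by
    rintro _ ⟨w, hw, rfl⟩
    exact hS w hw
  exact interior_mono this (hf.image_interior_subset S ⟨z, hz, rfl⟩)

theorem coords_of_mem_interior (hl : l ≠ 0) (hs : s ≠ 0) (hθ : Real.sin θ₀ ≠ 0)
    {p q w : ℝ} (hw : 0 < w) {z : Plane}
    (hz : z ∈ interior (scaledTranslate (parallelogram l s θ₀)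
      (q • l • longDir + p • s • shortDir θ₀) w)) :
    shortCoord s θ₀ z ∈ Set.Ioo p (p + w) ∧ longCoord l θ₀ z ∈ Set.Ioo q (q + w) :=
  ⟨(isOpenMap_shortCoord hs hθ).mem_Ioo_of_mem_interior
      (fun _ h => (coords_of_mem_scaledTranslate hl hs hθ hw h).1) hz,
    (isOpenMap_longCoord hl hθ).mem_Ioo_of_mem_interior
      (fun _ h => (coords_of_mem_scaledTranslate hl hs hθ hw h).2) hz⟩

/-- Points of the closed parallelogram lie on its boundary as soon as its interior contains no
vertex. Only one inclusion about interiors is needed: coordinates are open maps, so they send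
interior points into the open square. -/
theorem SquareAdj.delaunay_adj (hl : l ≠ 0) (hs : s ≠ 0) (hθ : Real.sin θ₀ ≠ 0)
    {V : Finset Plane} {u v : V}
    (H : SquareAdj (fun z : V => shortCoord s θ₀ z) (fun z : V => longCoord l θ₀ z) u v) :
    (delaunayGraph (parallelogram l s θ₀) V).Adj u v := by
  obtain ⟨hne, p, q, w, hw, ⟨hu1, hu2, hu3, hu4⟩, ⟨hv1, hv2, hv3, hv4⟩, hE⟩ := H
  have hV : ∀ z ∈ V, z ∉ interior (scaledTranslate (parallelogram l s θ₀)
      (q • l • longDir + p • s • shortDir θ₀) w) := fun z hz hi => by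
    obtain ⟨⟨h1, h2⟩, h3, h4⟩ := coords_of_mem_interior hl hs hθ hw hi
    exact hE ⟨z, hz⟩ h1 h2 h3 h4
  exact ⟨hne, _, w, hw,
    ⟨subset_closure (mem_scaledTranslate hl hs hθ hw hu1 hu2 hu3 hu4), hV u u.2⟩,
    ⟨subset_closure (mem_scaledTranslate hl hs hθ hw hv1 hv2 hv3 hv4), hV v v.2⟩, hV⟩

/-! ### Comparison of Euclidean and octagonal length. -/

/-- The ratio of the longer diagonal of the parallelogram to its long side. -/
noncomputable def diagonalRatio (l s θ₀ : ℝ) : ℝ :=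
  √(1 + 1 / (l / s) ^ 2 + 2 * |Real.cos θ₀| / (l / s))

theorem one_le_diagonalRatio (hl : 0 < l) (hs : 0 < s) : 1 ≤ diagonalRatio l s θ₀ := by
  rw [diagonalRatio, Real.one_le_sqrt]
  have h1 : 0 ≤ 1 / (l / s) ^ 2 := by positivity
  have h2 : 0 ≤ 2 * |Real.cos θ₀| / (l / s) := by positivity
  linarith

theorem diagonalRatio_le_two (hs : 0 < s) (hsl : s ≤ l) : diagonalRatio l s θ₀ ≤ 2 := by
  have hA : 1 ≤ l / s := (one_le_div hs).2 hsl
  rw [diagonalRatio, Real.sqrt_le_left (by norm_num)]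
  have h1 : 1 / (l / s) ^ 2 ≤ 1 := by
    rw [div_le_one (by positivity)]
    exact one_le_pow₀ hA
  have h2 : 2 * |Real.cos θ₀| / (l / s) ≤ 2 := by
    rw [div_le_iff₀ (by linarith)]
    have := Real.abs_cos_le_one θ₀
    linarith
  linarith

theorem mul_diagonalRatio (hl : 0 < l) (hs : 0 < s) :
    l * diagonalRatio l s θ₀ = √(l ^ 2 + s ^ 2 + 2 * l * s * |Real.cos θ₀|) := by
  rw [diagonalRatio, ← Real.sqrt_sq hl.le, ← Real.sqrt_mul (by positivity), Real.sqrt_sq hl.le]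
  congr 1
  field_simp

theorem norm_longDir : ‖longDir‖ = 1 := by
  simp [longDir, EuclideanSpace.norm_eq]

theorem norm_shortDir (θ₀ : ℝ) : ‖shortDir θ₀‖ = 1 := by
  simp [shortDir, EuclideanSpace.norm_eq]

theorem norm_diagonal_le (hl : 0 < l) (hs : 0 < s) {ε : ℝ} (hε : |ε| = 1) :
    ‖(ε * l) • longDir + s • shortDir θ₀‖ ≤ l * diagonalRatio l s θ₀ := by
  rw [mul_diagonalRatio hl hs, EuclideanSpace.norm_eq]
  refine Real.sqrt_le_sqrt ?_
  have h2 : ε * Real.cos θ₀ ≤ |Real.cos θ₀| := by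
    calc _ ≤ |ε * Real.cos θ₀| := le_abs_self _
      _ = _ := by rw [abs_mul, hε, one_mul]
  have h3 : ε ^ 2 = 1 := by rw [← sq_abs, hε, one_pow]
  have h4 := Real.sin_sq_add_cos_sq θ₀
  simp only [longDir, shortDir, Fin.sum_univ_two, Real.norm_eq_abs, sq_abs, PiLp.add_apply,
    PiLp.smul_apply, smul_eq_mul, Matrix.cons_val_zero, Matrix.cons_val_one]
  have h5 : 0 ≤ l * s * (|Real.cos θ₀| - ε * Real.cos θ₀) :=
    mul_nonneg (by positivity) (by linarith)
  have h6 : (ε * l * 0 + s * Real.sin θ₀) ^ 2 + (ε * l * 1 + s * Real.cos θ₀) ^ 2 =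
      s ^ 2 * (Real.sin θ₀ ^ 2 + Real.cos θ₀ ^ 2) + ε ^ 2 * l ^ 2 +
        2 * (l * s * (ε * Real.cos θ₀)) := by ring
  rw [h6, h4, h3]
  linarith

/-- The vector splits into a multiple of a diagonal, with coefficient the smaller of `|p|`, `|q|`,
and a remainder along one side. The sign `ε` selects the diagonal in the same quadrants as the
vector; a remainder along the short side is estimated by `s ≤ l`. -/
theorem norm_le_octNorm (hs : 0 < s) (hsl : s ≤ l) (p q : ℝ) :
    ‖q • l • longDir + p • s • shortDir θ₀‖ ≤ l * octNorm (diagonalRatio l s θ₀) p q := by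
  have hl : 0 < l := hs.trans_le hsl
  obtain ⟨ε, hε, hpq, hqp⟩ : ∃ ε : ℝ, |ε| = 1 ∧ |p - ε * q| = |(|p| - |q|)| ∧
      |q - ε * p| = |(|q| - |p|)| := by
    rcases le_total 0 p with hp | hp <;> rcases le_total 0 q with hq | hq
    · exact ⟨1, by simp, by simp [abs_of_nonneg hp, abs_of_nonneg hq],
        by simp [abs_of_nonneg hp, abs_of_nonneg hq]⟩
    · exact ⟨-1, by simp, by simp [abs_of_nonneg hp, abs_of_nonpos hq],
        by rw [abs_of_nonneg hp, abs_of_nonpos hq, ← abs_neg]; ring_nf⟩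
    · exact ⟨-1, by simp, by rw [abs_of_nonpos hp, abs_of_nonneg hq, ← abs_neg]; ring_nf,
        by simp [abs_of_nonpos hp, abs_of_nonneg hq]⟩
    · exact ⟨1, by simp, by rw [abs_of_nonpos hp, abs_of_nonpos hq, ← abs_neg]; ring_nf,
        by rw [abs_of_nonpos hp, abs_of_nonpos hq, ← abs_neg]; ring_nf⟩
  have hεε : ε * ε = 1 := by rw [← sq, ← sq_abs, hε, one_pow]
  have hd := norm_diagonal_le (θ₀ := θ₀) hl hs hε
  rcases le_total |q| |p| with h | h
  · rw [octNorm_of_le h]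
    have e : q • l • longDir + p • s • shortDir θ₀ =
        (ε * q) • ((ε * l) • longDir + s • shortDir θ₀) + (p - ε * q) • s • shortDir θ₀ := by
      have : q • l • longDir = (ε * ε) • q • l • longDir := by rw [hεε, one_smul]
      rw [this]
      module
    rw [e]
    refine (norm_add_le _ _).trans ?_
    simp only [norm_smul _ (_ + _), norm_smul (p - _), norm_smul s, norm_shortDir, Real.norm_eq_abs]
    rw [abs_mul, hε, hpq, abs_of_nonneg (sub_nonneg.2 h), abs_of_pos hs]
    have h1 := mul_le_mul_of_nonneg_left hd (abs_nonneg q)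
    have h2 := mul_le_mul_of_nonneg_left hsl (sub_nonneg.2 h)
    linarith
  · rw [octNorm_comm, octNorm_of_le h]
    have e : q • l • longDir + p • s • shortDir θ₀ =
        p • ((ε * l) • longDir + s • shortDir θ₀) + (q - ε * p) • l • longDir := by
      module
    rw [e]
    refine (norm_add_le _ _).trans ?_
    simp only [norm_smul _ (_ + _), norm_smul (q - _), norm_smul l, norm_longDir, Real.norm_eq_abs]
    rw [hqp, abs_of_nonneg (sub_nonneg.2 h), abs_of_pos hl]
    have h1 := mul_le_mul_of_nonneg_left hd (abs_nonneg p)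
    linarith

theorem Within.graphDist_le (hs : 0 < s) (hsl : s ≤ l) (hθ : Real.sin θ₀ ≠ 0)
    {V : Finset Plane} {u v : V} {r : ℝ}
    (H : Within (fun z : V => shortCoord s θ₀ z) (fun z : V => longCoord l θ₀ z)
      (diagonalRatio l s θ₀) u v r) :
    graphDist (delaunayGraph (parallelogram l s θ₀) V) u v ≤ ENNReal.ofReal (l * r) := by
  have hl : 0 < l := hs.trans_le hsl
  suffices ∃ w : (delaunayGraph (parallelogram l s θ₀) V).Walk u v,
      walkLength w ≤ ENNReal.ofReal (l * r) by
    obtain ⟨w, hw⟩ := this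
    exact (iInf_le _ w).trans hw
  induction H with
  | refl u r hr => exact ⟨.nil, by simp [walkLength]⟩
  | cons u v x r t huv hvx ht ih =>
    obtain ⟨w, hw⟩ := ih
    refine ⟨.cons (huv.delaunay_adj hl.ne' hs.ne' hθ) w, ?_⟩
    have hd : edist (u : Plane) v ≤ ENNReal.ofReal (l * octNorm (diagonalRatio l s θ₀)
        (shortCoord s θ₀ u - shortCoord s θ₀ v) (longCoord l θ₀ u - longCoord l θ₀ v)) := by
      rw [edist_dist, dist_eq_norm]
      refine ENNReal.ofReal_le_ofReal (le_trans (le_of_eq ?_) (norm_le_octNorm hs hsl _ _))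
      congr 1
      conv_lhs => rw [eq_coords hl.ne' hs.ne' hθ u.1, eq_coords hl.ne' hs.ne' hθ v.1]
      module
    have hr : walkLength (.cons (huv.delaunay_adj hl.ne' hs.ne' hθ) w) =
        edist (u : Plane) v + walkLength w := by
      simp [walkLength]
    rw [hr]
    refine (add_le_add hd hw).trans ?_
    have hK := one_le_diagonalRatio (θ₀ := θ₀) hl hs
    rw [← ENNReal.ofReal_add (mul_nonneg hl.le (octNorm_nonneg hK _ _))
      (mul_nonneg hl.le (hvx.nonneg hK)), ← mul_add]
    exact ENNReal.ofReal_le_ofReal (mul_le_mul_of_nonneg_left ht hl.le)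

theorem shortCoord_injective (hl : l ≠ 0) (hs : s ≠ 0) (hθ : Real.sin θ₀ ≠ 0)
    {V : Finset Plane} (hV : GeneralPosition l s θ₀ V) :
    Function.Injective fun z : V => shortCoord s θ₀ z := by
  intro u v h
  by_contra hne
  refine hV.no_two_long u u.2 v v.2 (fun h => hne (Subtype.ext h))
    ((longCoord l θ₀ v - longCoord l θ₀ u) * l) ?_
  conv_lhs => rw [eq_coords hl hs hθ u.1, eq_coords hl hs hθ v.1]
  simp only at h
  rw [h]
  module

theorem longCoord_injective (hl : l ≠ 0) (hs : s ≠ 0) (hθ : Real.sin θ₀ ≠ 0)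
    {V : Finset Plane} (hV : GeneralPosition l s θ₀ V) :
    Function.Injective fun z : V => longCoord l θ₀ z := by
  intro u v h
  by_contra hne
  refine hV.no_two_short u u.2 v v.2 (fun h => hne (Subtype.ext h))
    ((shortCoord s θ₀ v - shortCoord s θ₀ u) * s) ?_
  conv_lhs => rw [eq_coords hl hs hθ u.1, eq_coords hl hs hθ v.1]
  simp only at h
  rw [h]
  module

end

/-- The distance bound in coordinates. -/
theorem graphDist_le_of_coords {l s θ₀ : ℝ} (hs : 0 < s) (hsl : s ≤ l) (hθ : Real.sin θ₀ ≠ 0)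
    {V : Finset Plane} (hV : GeneralPosition l s θ₀ V) (a b : V) {p q r : ℝ}
    (hp : |shortCoord s θ₀ a - shortCoord s θ₀ b| = p)
    (hq : |longCoord l θ₀ a - longCoord l θ₀ b| = q)
    (hr : l * ((1 + diagonalRatio l s θ₀) * max p q + min p q) = r) :
    graphDist (delaunayGraph (parallelogram l s θ₀) V) a b ≤ ENNReal.ofReal r := by
  have hl : 0 < l := hs.trans_le hsl
  subst hp hq hr
  exact (good (shortCoord_injective hl.ne' hs.ne' hθ hV) (longCoord_injective hl.ne' hs.ne' hθ hV)
    (one_le_diagonalRatio hl hs) (diagonalRatio_le_two hs hsl) a b).graphDist_le hs hsl hθ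

end ParallelogramDelaunay

/-! ### The four scenarios. -/

open ParallelogramDelaunay in
theorem mainTheorem1 (l s θ₀ : ℝ) (hs : 0 < s) (hsl : s ≤ l)
    (hθ₀ : 0 < θ₀) (hθ₀' : θ₀ ≤ Real.pi / 2)
    (V : Finset ParallelogramDelaunay.Plane)
    (hV : ParallelogramDelaunay.GeneralPosition l s θ₀ V)
    (A : ℝ) (hA : A = l / s)
    (a b : V) (hab : a.1 0 < b.1 0)
    (σ : ParallelogramDelaunay.Scenario)
    (hσ : (b.1 1 - a.1 1) / (b.1 0 - a.1 0) ∈ σ.slopes A θ₀) :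
    ((σ = .two ∨ σ = .three) →
      ParallelogramDelaunay.graphDist
          (ParallelogramDelaunay.delaunayGraph
            (ParallelogramDelaunay.parallelogram l s θ₀) V) a b ≤
        ENNReal.ofReal
          ((A + √(1 + A ^ 2 + 2 * A * |Real.cos (σ.theta θ₀)|)) * σ.xCoord θ₀ (b.1 - a.1)
            + σ.yCoord θ₀ (b.1 - a.1))) ∧
    ((σ = .one ∨ σ = .four) →
      ParallelogramDelaunay.graphDist
          (ParallelogramDelaunay.delaunayGraph
            (ParallelogramDelaunay.parallelogram l s θ₀) V) a b ≤
        ENNReal.ofReal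
          ((1 + √(1 + 1 / A ^ 2 + 2 * |Real.cos (σ.theta θ₀)| / A)) * σ.xCoord θ₀ (b.1 - a.1)
            + A * σ.yCoord θ₀ (b.1 - a.1))) := by
  have hsin : 0 < Real.sin θ₀ := Real.sin_pos_of_pos_of_lt_pi hθ₀ (by linarith [Real.pi_pos])
  have hl : 0 < l := hs.trans_le hsl
  have hA0 : 0 < A := by rw [hA]; positivity
  have hlA : l = A * s := by rw [hA]; field_simp
  have hcos : |Real.cos (σ.theta θ₀)| = |Real.cos θ₀| := by
    cases σ <;> simp [Scenario.theta, Real.cos_pi_sub]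
  have hK : √(1 + 1 / A ^ 2 + 2 * |Real.cos θ₀| / A) = diagonalRatio l s θ₀ := by
    rw [diagonalRatio, hA]
  have hK' : √(1 + A ^ 2 + 2 * A * |Real.cos θ₀|) = A * diagonalRatio l s θ₀ := by
    rw [← hK, ← Real.sqrt_sq hA0.le, ← Real.sqrt_mul (by positivity), Real.sqrt_sq hA0.le]
    congr 1
    field_simp
    ring
  rw [hcos, hK, hK']
  have hdx : 0 < b.1 0 - a.1 0 := sub_pos.2 hab
  -- Here `x` and `y` are the components of `b - a` along the unit vectors of the short and the long
  -- side. Scenarios 2 and 3 amount to gentle pairs, `|y| ≤ A * x`, and scenarios 1 and 4 to steep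
  -- ones; the sign of `y` separates the two within each kind.
  set x := (b.1 0 - a.1 0) / Real.sin θ₀ with hx
  set y := (b.1 1 - a.1 1) - x * Real.cos θ₀ with hy
  have hx0 : 0 < x := div_pos hdx hsin
  have hp : |shortCoord s θ₀ a - shortCoord s θ₀ b| = x / s := by
    have : shortCoord s θ₀ a - shortCoord s θ₀ b = -(x / s) := by
      rw [hx, shortCoord, shortCoord]
      field_simp
      ring
    rw [this, abs_neg, abs_of_pos (by positivity)]
  have hq : |longCoord l θ₀ a - longCoord l θ₀ b| = |y| / l := by
    have : longCoord l θ₀ a - longCoord l θ₀ b = -(y / l) := by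
      rw [hy, hx, longCoord, longCoord]
      field_simp
      ring
    rw [this, abs_neg, abs_div, abs_of_pos hl]
  have hslope : (b.1 1 - a.1 1) / (b.1 0 - a.1 0) = (Real.cos θ₀ + y / x) / Real.sin θ₀ := by
    rw [hy, hx]
    field_simp
    ring
  rw [hslope] at hσ
  have hgentle : |y| ≤ A * x → ∀ r, (A + A * diagonalRatio l s θ₀) * x + |y| = r →
      graphDist (delaunayGraph (parallelogram l s θ₀) V) a b ≤ ENNReal.ofReal r := by
    intro h r hr
    have h' : |y| / l ≤ x / s := by
      rw [div_le_div_iff₀ hl hs, hlA]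
      nlinarith
    refine graphDist_le_of_coords hs hsl hsin.ne' hV a b hp hq ?_
    rw [max_eq_left h', min_eq_right h', ← hr, hlA]
    field_simp
  have hsteep : A * x ≤ |y| → ∀ r, (1 + diagonalRatio l s θ₀) * |y| + A * x = r →
      graphDist (delaunayGraph (parallelogram l s θ₀) V) a b ≤ ENNReal.ofReal r := by
    intro h r hr
    have h' : x / s ≤ |y| / l := by
      rw [div_le_div_iff₀ hs hl, hlA]
      nlinarith
    refine graphDist_le_of_coords hs hsl hsin.ne' hV a b hp hq ?_
    rw [max_eq_right h', min_eq_left h', ← hr, hlA]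
    field_simp
  cases σ
  · rw [Scenario.slopes, Set.mem_Iic, div_le_div_iff_of_pos_right hsin] at hσ
    have h1 : y / x ≤ -A := by linarith
    rw [div_le_iff₀ hx0] at h1
    have h2 : y ≤ 0 := by nlinarith
    refine ⟨by simp, fun _ => hsteep (by rw [abs_of_nonpos h2]; linarith) _ ?_⟩
    rw [abs_of_nonpos h2, hy, hx]
    simp only [Scenario.xCoord, Scenario.yCoord, Scenario.area, Scenario.xHat, Scenario.yHat,
      PiLp.sub_apply, Matrix.cons_val_zero, Matrix.cons_val_one, mul_neg, zero_mul,
      one_mul, neg_mul, sub_neg_eq_add, zero_add]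
    field_simp
    ring
  · rw [Scenario.slopes, Set.mem_Ioc, div_lt_div_iff_of_pos_right hsin,
      div_le_div_iff_of_pos_right hsin] at hσ
    have h1 : -A < y / x := by linarith
    have h2 : y / x ≤ 0 := by linarith
    rw [lt_div_iff₀ hx0] at h1
    rw [div_le_iff₀ hx0, zero_mul] at h2
    refine ⟨fun _ => hgentle (by rw [abs_of_nonpos h2]; linarith) _ ?_, by simp⟩
    rw [abs_of_nonpos h2, hy, hx]
    simp only [Scenario.xCoord, Scenario.yCoord, Scenario.area, Scenario.xHat, Scenario.yHat,
      PiLp.sub_apply, Matrix.cons_val_zero, Matrix.cons_val_one, mul_zero, mul_one,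
      mul_neg, sub_zero]
    field_simp
  · rw [Scenario.slopes, Set.mem_Ioc, div_lt_div_iff_of_pos_right hsin,
      div_le_div_iff_of_pos_right hsin] at hσ
    have h1 : y / x ≤ A := by linarith
    have h2 : 0 < y / x := by linarith
    rw [div_le_iff₀ hx0] at h1
    rw [lt_div_iff₀ hx0, zero_mul] at h2
    refine ⟨fun _ => hgentle (by rw [abs_of_pos h2]; linarith) _ ?_, by simp⟩
    rw [abs_of_pos h2, hy, hx]
    simp only [Scenario.xCoord, Scenario.yCoord, Scenario.area, Scenario.xHat, Scenario.yHat,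
      PiLp.sub_apply, Matrix.cons_val_zero, Matrix.cons_val_one, mul_zero, mul_one,
      sub_zero]
    field_simp
  · rw [Scenario.slopes, Set.mem_Ioi, div_lt_div_iff_of_pos_right hsin] at hσ
    have h1 : A < y / x := by linarith
    rw [lt_div_iff₀ hx0] at h1
    have h2 : 0 ≤ y := by nlinarith
    refine ⟨by simp, fun _ => hsteep (by rw [abs_of_nonneg h2]; linarith) _ ?_⟩
    rw [abs_of_nonneg h2, hy, hx]
    simp only [Scenario.xCoord, Scenario.yCoord, Scenario.area, Scenario.xHat, Scenario.yHat,
      PiLp.sub_apply, Matrix.cons_val_zero, Matrix.cons_val_one, zero_mul, one_mul,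
      zero_sub]
    field_simp
    ring
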